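/- A randomized algorithm for $k$ counters keeps its memory as a finite bit string. Its initial memory may be random; on an operation $\mathtt{increment}(i)$, $1\le i\le k$, the new memory is a function of the old memory, of $i$ and of fresh independent randomness; on $\mathtt{query}(i)$ it returns a real number $\hat N_i$ that is a function of the memory, of $i$ and of fresh independent randomness. For a finite sequence of increments, let $N_i$ be the number of operations $\mathtt{increment}(i)$ in it. The algorithm is a $(k,\varepsilon,\delta)$-approximate counter if, after every finite sequence of increments and for every $i$, $$\mathbb{P}\bigl(\hat N_i\neq N_i\ \text{and}\ |\hat N_i-N_i|\ge \varepsilon N_i\bigr)\le\delta$$ (for $N_i\ge 1$ the event is just $|\hat N_i-N_i|\ge\varepsilon N_i$; for $N_i=0$ it is $\hat N_i\ne 0$). The space it uses on a sequence of increments is the maximum length of its memory over the whole run, a random variable. There is a universal constant $C>0$ such that for all $\varepsilon,\delta\in(0,1/2)$ and every integer $k\ge 1$ there is a $(k,\varepsilon,\delta)$-approximate counter with the following property: for every $N\ge k$, on every sequence of $N$ increments (that is, with $\sum_{i=1}^k N_i=N$), the expected space it uses is at most $$C\,k\left(\log_2\log_2\frac{2N}{k}+\log_2\log_2\frac1\delta+\log_2\frac1\varepsilon\right)\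 \text{bits}.$$ In particular the algorithm does not need to know $N$. -/

import Mathlib

open scoped ENNReal

/-- A randomized streaming algorithm for `k` counters, described by its memory states.
The memory is a bit string. The initial memory may be random; after `increment i` the new memory
is a function of the old memory, of `i` and of fresh independent randomness, that is, it is drawn
from a distribution depending only on the old memory and `i`. A query reads the memory (and may use
fresh randomness) and returns a number, without changing the memory. -/
structure CounterAlg (k : ℕ) where
  init : PMF (List Bool)
  increment : Fin k → List Bool → PMF (List Bool)
  query : Fin k → List Bool → PMF ℝ

namespace CounterAlg

variable {k : ℕ}

/-- One step of a run on the pairs (current memory, largest number of bits of memory held so far):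
apply `increment i`. -/
noncomputable def step (A : CounterAlg k) (i : Fin k) (s : List Bool × ℕ) :
    PMF (List Bool × ℕ) :=
  (A.increment i s.1).map fun m => (m, max s.2 m.length)

/-- The joint law of (current memory, largest number of bits of memory held so far) after the
increments listed in `ops` have been processed from left to right. -/
noncomputable def run (A : CounterAlg k) (ops : List (Fin k)) : PMF (List Bool × ℕ) :=
  ops.foldl (fun p i => p.bind (A.step i)) (A.init.map fun m => (m, m.length))

/-- The law of the value returned by `query i` after the increments `ops`. -/
noncomputable def answer (A : CounterAlg k) (ops : List (Fin k)) (i : Fin k) : PMF ℝ :=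
  (A.run ops).bind fun s => A.query i s.1

/-- The expected space, in bits, on the increment sequence `ops`: the expectation of the
largest number of bits of memory held at any time from the start to the end of the run. -/
noncomputable def expectedSpace (A : CounterAlg k) (ops : List (Fin k)) : ℝ≥0∞ :=
  ∑' s : List Bool × ℕ, A.run ops s * (s.2 : ℝ≥0∞)

/-- `A` is a `(k, ε, δ)`-approximate counter: after any finite sequence of increments, for every
`i`, with `N = N_i` the number of increments of the `i`-th counter, the answer `x` to `query i`
satisfies `|x - N| ≥ ε N` with probability at most `δ`. An exact answer `x = N` never counts
as an error; for `ε > 0` this matters only if `N = 0`, where the condition says that the answer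
is `0` except with probability at most `δ`. -/
def IsApproxCounter (A : CounterAlg k) (ε δ : ℝ) : Prop :=
  ∀ (ops : List (Fin k)) (i : Fin k),
    (A.answer ops i).toOuterMeasure
      {x : ℝ | x ≠ (ops.count i : ℝ) ∧ ε * (ops.count i : ℝ) ≤ |x - (ops.count i : ℝ)|}
      ≤ ENNReal.ofReal δ

end CounterAlg

/-! Each counter is a Morris-type counter with dyadic rates: in state `x` an increment succeeds with
probability `2 ^ -(x / M)`, and success raises the represented value by `2 ^ (x / M)`. Values are
therefore unbiased, and all jumps up to a level of value `V` are at most `1 + V / M`.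

Accuracy: products of the factors `1 ± θ * 2 ^ (j / M)` over the levels passed are multiplied by `1
± θ` in expectation per increment (for the lower tail, at most). Markov's inequality then gives
`upper_tail` and `lower_tail`, each with probability at most `exp (-ε² M / 16)`, so `M ≈ log (1/δ) /
ε²` suffices. Counts up to `M` are exact.

Space: the states are stored in a self-delimiting code. A state has about `log M + log log` (value)
bits; `size_le_of_value` bounds this by its size at the average `N / k` plus a term linear in the
value. Since the values sum to `N` in expectation, the linear terms cost `O(k)`, however the
increments are distributed and without knowledge of `N`. -/

/-! ### Expectations under a probability mass function. -/

namespace PMF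

/-- The expectation of a nonnegative function under a probability mass function. -/
noncomputable def expect {α : Type*} (p : PMF α) (f : α → ℝ≥0∞) : ℝ≥0∞ := ∑' a, p a * f a

variable {α β : Type*}

theorem expect_pure (a : α) (f : α → ℝ≥0∞) : (PMF.pure a).expect f = f a := by
  rw [expect, tsum_eq_single a]
  · simp
  · intro b hb
    simp [PMF.pure_apply, hb]

theorem expect_bind (p : PMF α) (q : α → PMF β) (f : β → ℝ≥0∞) :
    (p.bind q).expect f = p.expect fun a => (q a).expect f := by
  simp only [expect, PMF.bind_apply, ← ENNReal.tsum_mul_left, ← ENNReal.tsum_mul_right]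
  rw [ENNReal.tsum_comm]
  simp only [mul_assoc]

theorem expect_map (p : PMF α) (g : α → β) (f : β → ℝ≥0∞) :
    (p.map g).expect f = p.expect fun a => f (g a) := by
  rw [← PMF.bind_pure_comp, expect_bind]
  simp only [Function.comp, expect_pure]

theorem expect_mono (p : PMF α) {f g : α → ℝ≥0∞} (h : ∀ a, f a ≤ g a) :
    p.expect f ≤ p.expect g :=
  ENNReal.tsum_le_tsum fun a => mul_le_mul_right (h a) _

theorem expect_add (p : PMF α) (f g : α → ℝ≥0∞) :
    (p.expect fun a => f a + g a) = p.expect f + p.expect g := by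
  simp only [expect, mul_add, ENNReal.tsum_add]

theorem expect_const (p : PMF α) (c : ℝ≥0∞) : (p.expect fun _ => c) = c := by
  simp only [expect, ENNReal.tsum_mul_right, PMF.tsum_coe, one_mul]

theorem expect_const_mul (p : PMF α) (c : ℝ≥0∞) (f : α → ℝ≥0∞) :
    (p.expect fun a => c * f a) = c * p.expect f := by
  simp only [expect, mul_left_comm _ c, ENNReal.tsum_mul_left]

/-- Markov's inequality. -/
theorem mul_toOuterMeasure_le_expect (p : PMF α) (f : α → ℝ≥0∞) (S : Set α) (c : ℝ≥0∞)
    (h : ∀ a ∈ S, c ≤ f a) : c * p.toOuterMeasure S ≤ p.expect f := by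
  rw [PMF.toOuterMeasure_apply, ← ENNReal.tsum_mul_left]
  refine ENNReal.tsum_le_tsum fun a => ?_
  by_cases ha : a ∈ S
  · rw [Set.indicator_of_mem ha, mul_comm]
    exact mul_le_mul_right (h a ha) _
  · simp [Set.indicator_of_notMem ha]

end PMF

/-! ### Levels and values of a dyadic counter. -/

namespace DyadicCounter

/-- A coin that shows `true` with probability `2⁻ᵉ`. -/
noncomputable def coin (e : ℕ) : PMF Bool :=
  PMF.ofFintype
    (fun b => cond b (ENNReal.ofReal (2 ^ e)⁻¹) (ENNReal.ofReal (1 - (2 ^ e : ℝ)⁻¹))) (by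
      have h1 : (0 : ℝ) ≤ (2 ^ e)⁻¹ := by positivity
      have h2 : ((2 : ℝ) ^ e)⁻¹ ≤ 1 := inv_le_one_of_one_le₀ (one_le_pow₀ (by norm_num))
      rw [Fintype.sum_bool, cond_true, cond_false, ← ENNReal.ofReal_add h1 (by linarith)]
      simp)

theorem expect_coin (e : ℕ) (f : Bool → ℝ≥0∞) :
    (coin e).expect f =
      ENNReal.ofReal (2 ^ e)⁻¹ * f true + ENNReal.ofReal (1 - (2 ^ e : ℝ)⁻¹) * f false := by
  rw [PMF.expect, tsum_fintype, Fintype.sum_bool]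
  rfl

theorem coin_zero_false : coin 0 false = 0 := by
  simp [coin, PMF.ofFintype_apply]

/-- The value represented by state `x`: state `j` stands for a jump of `2 ^ (j / M)`. -/
def value (M x : ℕ) : ℕ := ∑ j ∈ Finset.range x, 2 ^ (j / M)

theorem value_succ (M x : ℕ) : value M (x + 1) = value M x + 2 ^ (x / M) :=
  Finset.sum_range_succ _ _

theorem value_strictMono (M : ℕ) : StrictMono (value M) :=
  strictMono_nat_of_lt_succ fun x => by
    rw [value_succ]
    exact Nat.lt_add_of_pos_right (by positivity)

theorem value_eq_self {M x : ℕ} (h : x ≤ M) : value M x = x := by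
  rw [value, Finset.sum_congr rfl (g := fun _ => 1)]
  · simp
  · intro j hj
    rw [Nat.div_eq_of_lt (by have := Finset.mem_range.1 hj; omega), pow_zero]

/-- With `q = x / M`, the completed blocks contribute `M (1 + 2 + ... + 2 ^ (q - 1)) = M (2 ^ q -
1)`, and the `x % M` remaining jumps are `2 ^ q` each. -/
theorem add_value {M : ℕ} (hM : 0 < M) (x : ℕ) :
    M + value M x = (M + x % M) * 2 ^ (x / M) := by
  induction x with
  | zero => simp [value]
  | succ x ih =>
    rw [value_succ, ← add_assoc, ih]
    have hlt := Nat.mod_lt x hM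
    have hx := Nat.div_add_mod x M
    rcases Nat.lt_or_ge (x % M + 1) M with h | h
    · have hd : (x + 1) / M = x / M := by
        rw [Nat.div_eq_iff hM]
        rw [mul_comm] at hx
        constructor <;> omega
      have hm := Nat.div_add_mod (x + 1) M
      rw [hd] at hm
      rw [hd, show (x + 1) % M = x % M + 1 by omega]
      ring
    · have hd : (x + 1) / M = x / M + 1 := by
        rw [Nat.div_eq_iff hM]
        rw [mul_comm] at hx
        rw [add_mul]
        constructor <;> omega
      have hm := Nat.div_add_mod (x + 1) M
      rw [hd, mul_add] at hm
      rw [hd, show (x + 1) % M = 0 by omega, show x % M = M - 1 by omega, pow_succ]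
      obtain ⟨m, rfl⟩ : ∃ m, M = m + 1 := ⟨M - 1, by omega⟩
      simp only [Nat.add_sub_cancel]
      ring

theorem mul_two_pow_div_le {M : ℕ} (hM : 0 < M) (x : ℕ) :
    M * 2 ^ (x / M) ≤ M + value M x := by
  rw [add_value hM]
  exact Nat.mul_le_mul_right _ (Nat.le_add_right _ _)

theorem two_pow_div_le {M : ℕ} (hM : 0 < M) (x : ℕ) :
    (2 : ℝ) ^ (x / M) ≤ 1 + value M x / M := by
  have h : ((M * 2 ^ (x / M) : ℕ) : ℝ) ≤ ((M + value M x : ℕ) : ℝ) :=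
    Nat.cast_le.2 (mul_two_pow_div_le hM x)
  push_cast at h
  have hM' : (0 : ℝ) < M := by exact_mod_cast hM
  rw [← mul_le_mul_iff_right₀ hM', mul_add, mul_div_cancel₀ _ hM'.ne']
  linarith

/-! ### Random evolution of the counter vector. -/

variable {k : ℕ}

/-- One increment of counter `i` in the vector `v` of counter states. -/
noncomputable def vecStep (M : ℕ) (i : Fin k) (v : Fin k → ℕ) : PMF (Fin k → ℕ) :=
  (coin (v i / M)).map fun b => cond b (Function.update v i (v i + 1)) v

/-- The law of the vector of counter states after the increments `ops`. -/
noncomputable def law (M : ℕ) (ops : List (Fin k)) : PMF (Fin k → ℕ) :=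
  ops.foldl (fun p i => p.bind (vecStep M i)) (PMF.pure 0)

theorem law_nil (M : ℕ) : law M ([] : List (Fin k)) = PMF.pure 0 := rfl

theorem law_concat (M : ℕ) (ops : List (Fin k)) (i : Fin k) :
    law M (ops ++ [i]) = (law M ops).bind (vecStep M i) := by
  simp [law]

theorem expect_vecStep (M : ℕ) (i : Fin k) (v : Fin k → ℕ) (f : (Fin k → ℕ) → ℝ≥0∞) :
    (vecStep M i v).expect f =
      ENNReal.ofReal (2 ^ (v i / M))⁻¹ * f (Function.update v i (v i + 1)) +
        ENNReal.ofReal (1 - (2 ^ (v i / M) : ℝ)⁻¹) * f v := by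
  rw [vecStep, PMF.expect_map, expect_coin]
  rfl

theorem inv_two_pow_le_one (e : ℕ) : ((2 : ℝ) ^ e)⁻¹ ≤ 1 :=
  inv_le_one_of_one_le₀ (one_le_pow₀ (by norm_num))

/-- A function of one counter that grows by a factor of at most `s` per increment in expectation
has expectation at most `s ^ n * W 0` after `n` increments of this counter. -/
theorem expect_law_le (M : ℕ) (i : Fin k) (W : ℕ → ℝ) (s : ℝ) (hs : 0 ≤ s) (hW : ∀ x, 0 ≤ W x)
    (h : ∀ x, ((2 : ℝ) ^ (x / M))⁻¹ * W (x + 1) + (1 - ((2 : ℝ) ^ (x / M))⁻¹) * W x ≤ s * W x)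
    (ops : List (Fin k)) :
    ((law M ops).expect fun v => ENNReal.ofReal (W (v i))) ≤
      ENNReal.ofReal (s ^ ops.count i * W 0) := by
  induction ops using List.reverseRecOn with
  | nil => simp [law_nil, PMF.expect_pure]
  | append_singleton ops j ih =>
    rw [law_concat, PMF.expect_bind]
    by_cases hj : j = i
    · subst hj
      calc _ ≤ (law M ops).expect fun v => ENNReal.ofReal s * ENNReal.ofReal (W (v j)) := by
            refine PMF.expect_mono _ fun v => ?_
            have h1 := inv_two_pow_le_one (v j / M)
            have h2 : (0 : ℝ) ≤ (2 ^ (v j / M))⁻¹ := by positivity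
            rw [expect_vecStep, Function.update_self, ← ENNReal.ofReal_mul h2,
              ← ENNReal.ofReal_mul (by linarith), ← ENNReal.ofReal_mul hs,
              ← ENNReal.ofReal_add (mul_nonneg h2 (hW _))
                (mul_nonneg (by linarith) (hW _))]
            exact ENNReal.ofReal_le_ofReal (h (v j))
        _ ≤ ENNReal.ofReal s * ENNReal.ofReal (s ^ ops.count j * W 0) := by
            rw [PMF.expect_const_mul]
            exact mul_le_mul_right ih _
        _ = _ := by
            rw [← ENNReal.ofReal_mul hs, List.count_append, List.count_singleton_self, pow_succ]
            ring_nf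
    · have hcount : (ops ++ [j]).count i = ops.count i := by
        rw [List.count_append, List.count_singleton]
        simp [hj]
      rw [hcount]
      refine le_trans (PMF.expect_mono _ fun v => ?_) ih
      rw [expect_vecStep, Function.update_of_ne (Ne.symm hj), ← add_mul, ← ENNReal.ofReal_add
        (by positivity) (sub_nonneg.2 (inv_two_pow_le_one _))]
      simp

theorem law_tail_le (M : ℕ) (i : Fin k) (W : ℕ → ℝ) (s : ℝ) (hs : 0 ≤ s) (hW : ∀ x, 0 ≤ W x)
    (h : ∀ x, ((2 : ℝ) ^ (x / M))⁻¹ * W (x + 1) + (1 - ((2 : ℝ) ^ (x / M))⁻¹) * W x ≤ s * W x)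
    (ops : List (Fin k)) (S : Set (Fin k → ℕ)) (c β : ℝ) (hc : 0 < c)
    (hS : ∀ v ∈ S, c ≤ W (v i)) (hβ : s ^ ops.count i * W 0 ≤ β * c) :
    (law M ops).toOuterMeasure S ≤ ENNReal.ofReal β := by
  have h1 := (PMF.mul_toOuterMeasure_le_expect (law M ops) (fun v => ENNReal.ofReal (W (v i))) S
    (ENNReal.ofReal c) fun v hv => ENNReal.ofReal_le_ofReal (hS v hv)).trans
    ((expect_law_le M i W s hs hW h ops).trans (ENNReal.ofReal_le_ofReal hβ))
  rw [mul_comm β, ENNReal.ofReal_mul hc.le] at h1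
  exact (ENNReal.mul_le_mul_iff_right (by simpa using hc) ENNReal.ofReal_ne_top).1 h1

/-- The values of the counters are unbiased. -/
theorem expect_sum_value (M : ℕ) (ops : List (Fin k)) :
    ((law M ops).expect fun v => ∑ i, (value M (v i) : ℝ≥0∞)) = ops.length := by
  induction ops using List.reverseRecOn with
  | nil => simp [law_nil, PMF.expect_pure, value]
  | append_singleton ops j ih =>
    rw [law_concat, PMF.expect_bind, List.length_append, List.length_singleton, Nat.cast_add,
      ← ih, Nat.cast_one, ← PMF.expect_const (law M ops) 1, ← PMF.expect_add]
    congr 1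
    funext v
    rw [expect_vecStep]
    have h0 := sub_nonneg.2 (inv_two_pow_le_one (v j / M))
    have hupd : ∑ i, (value M (Function.update v j (v j + 1) i) : ℝ≥0∞) =
        ∑ i, (value M (v i) : ℝ≥0∞) + ENNReal.ofReal (2 ^ (v j / M)) := by
      rw [← Finset.add_sum_erase _ _ (Finset.mem_univ j),
        ← Finset.add_sum_erase _ (fun i => (value M (v i) : ℝ≥0∞)) (Finset.mem_univ j),
        Function.update_self, value_succ, ENNReal.ofReal_pow (by norm_num)]
      rw [Finset.sum_congr rfl (g := fun i => (value M (v i) : ℝ≥0∞))]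
      · push_cast
        simp only [ENNReal.ofReal_ofNat]
        ring
      · intro i hi
        rw [Function.update_of_ne (Finset.ne_of_mem_erase hi)]
    rw [hupd, mul_add, add_right_comm, ← add_mul, ← ENNReal.ofReal_add (by positivity) h0,
      ← ENNReal.ofReal_mul (by positivity), inv_mul_cancel₀ (by positivity)]
    simp

/-- Below level `M` the coin has exponent `0` and never fails. This covers the counts, `0` included,
for which the tail bounds are not available. -/
theorem eq_count_of_mem_support_law {M : ℕ} (i : Fin k) (ops : List (Fin k))
    (h : ops.count i ≤ M) (v : Fin k → ℕ) (hv : v ∈ (law M ops).support) :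
    v i = ops.count i := by
  induction ops using List.reverseRecOn generalizing v with
  | nil =>
    rw [law_nil, PMF.mem_support_pure_iff] at hv
    simp [hv]
  | append_singleton ops j ih =>
    rw [law_concat, PMF.mem_support_bind_iff] at hv
    obtain ⟨u, hu, hv⟩ := hv
    rw [vecStep, PMF.mem_support_map_iff] at hv
    obtain ⟨b, hb, rfl⟩ := hv
    rw [List.count_append] at h ⊢
    have hui := ih (by omega) u hu
    by_cases hj : j = i
    · subst hj
      rw [List.count_singleton_self] at h ⊢
      cases b with
      | true => simp [hui]
      | false =>
        rw [PMF.mem_support_iff, Nat.div_eq_of_lt (by omega)] at hb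
        exact absurd coin_zero_false hb
    · have : List.count i [j] = 0 := by simp [hj]
      rw [this, add_zero, ← hui]
      cases b with
      | true => exact Function.update_of_ne (Ne.symm hj) _ _
      | false => rfl

/-! ### Exponential tail bounds. -/

theorem exp_le_one_add {u : ℝ} (hu : 0 ≤ u) : Real.exp (u - u ^ 2 / 2) ≤ 1 + u := by
  rw [← Real.le_log_iff_exp_le (by linarith)]
  refine le_trans ?_ (Real.le_log_one_add_of_nonneg hu)
  rw [le_div_iff₀ (by linarith)]
  nlinarith [pow_nonneg hu 3]

theorem exp_le_one_sub {u : ℝ} (hu' : u ≤ 1 / 2) :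
    Real.exp (-u - 2 * u ^ 2) ≤ 1 - u := by
  rw [← Real.le_log_iff_exp_le (by linarith)]
  refine le_trans ?_ (Real.one_sub_inv_le_log_of_pos (by linarith))
  rw [inv_eq_one_div, le_sub_iff_add_le, ← le_sub_iff_add_le', div_le_iff₀ (by linarith)]
  nlinarith [mul_nonneg (sq_nonneg u) (show (0 : ℝ) ≤ 1 - 2 * u by linarith)]

theorem cast_value (M x : ℕ) : (value M x : ℝ) = ∑ j ∈ Finset.range x, (2 : ℝ) ^ (j / M) := by
  simp [value]

/-- The jumps up to level `x` have small square sum. -/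
theorem sum_sq_le {M : ℕ} (hM : 0 < M) (x : ℕ) :
    ∑ j ∈ Finset.range x, ((2 : ℝ) ^ (j / M)) ^ 2 ≤ (1 + value M x / M) * value M x := by
  rw [cast_value M x, Finset.mul_sum, ← cast_value M x]
  refine Finset.sum_le_sum fun j hj => ?_
  rw [sq]
  refine mul_le_mul_of_nonneg_right ?_ (by positivity)
  exact (pow_le_pow_right₀ (by norm_num)
    (Nat.div_le_div_right (Finset.mem_range.1 hj).le)).trans (two_pow_div_le hM x)

/-- Reaching the first level `x` of value at least `(1 + ε) N` forces the product to be at least its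
value at `x`, while its mean is at most `(1 + θ) ^ N`. -/
theorem upper_tail {M : ℕ} (hM : 0 < M) {ε : ℝ} (hε : 0 < ε) (hε' : ε < 1 / 2) (i : Fin k)
    (ops : List (Fin k)) (hN : M ≤ ops.count i) :
    (law M ops).toOuterMeasure {v | (1 + ε) * (ops.count i : ℝ) ≤ value M (v i)} ≤
      ENNReal.ofReal (Real.exp (-(ε ^ 2 * M / 16))) := by
  set N := ops.count i with hNdef
  have hMr : (0 : ℝ) < M := by exact_mod_cast hM
  have hNr : (M : ℝ) ≤ N := by exact_mod_cast hN
  have hex : ∃ x : ℕ, (1 + ε) * (N : ℝ) ≤ value M x :=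
    ⟨⌈(1 + ε) * (N : ℝ)⌉₊, (Nat.le_ceil _).trans
      (Nat.cast_le.2 ((value_strictMono M).le_apply))⟩
  classical
  set x := Nat.find hex with hx
  have hxV : (1 + ε) * (N : ℝ) ≤ value M x := Nat.find_spec hex
  set V : ℝ := (value M x : ℝ) with hV
  have hVM : (M : ℝ) ≤ V := by nlinarith
  have hVpos : 0 < V := by linarith
  -- The exponent gained is at least `(2/3) ε t - t² / M` with `t = θ V`; this is largest at `t = ε
  -- M / 3`.
  set θ : ℝ := ε * M / (3 * V) with hθ
  have hθ0 : 0 < θ := by positivity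
  have hf : ∀ j : ℕ, 1 ≤ 1 + θ * 2 ^ (j / M) := fun j => by
    have : 0 < θ * 2 ^ (j / M) := by positivity
    linarith
  refine law_tail_le M i (fun y => ∏ j ∈ Finset.range y, (1 + θ * 2 ^ (j / M))) (1 + θ)
    (by linarith) (fun y => Finset.prod_nonneg fun j _ => by linarith [hf j]) ?_ ops _
    (∏ j ∈ Finset.range x, (1 + θ * 2 ^ (j / M))) _
    (Finset.prod_pos fun j _ => by linarith [hf j]) ?_ ?_
  · intro y
    rw [Finset.prod_range_succ]
    refine le_of_eq ?_
    have : (2 : ℝ) ^ (y / M) ≠ 0 := by positivity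
    field_simp
    ring
  · intro v hv
    have hxv : x ≤ v i := Nat.find_min' hex hv
    exact Finset.prod_le_prod_of_subset_of_one_le (Finset.range_subset_range.2 hxv)
      (fun j _ => by linarith [hf j]) fun j _ _ => hf j
  · simp only [Finset.range_zero, Finset.prod_empty, mul_one]
    have h1 : (1 + θ) ^ N ≤ Real.exp (N * θ) := by
      rw [Real.exp_nat_mul]
      exact pow_le_pow_left₀ (by linarith) (by linarith [Real.add_one_le_exp θ]) _
    have h2 : Real.exp (θ * V - θ ^ 2 / 2 * ((1 + V / M) * V)) ≤
        ∏ j ∈ Finset.range x, (1 + θ * 2 ^ (j / M)) := by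
      calc _ ≤ Real.exp (∑ j ∈ Finset.range x,
            (θ * 2 ^ (j / M) - (θ * 2 ^ (j / M)) ^ 2 / 2)) := by
            refine Real.exp_le_exp.2 ?_
            rw [Finset.sum_sub_distrib, ← Finset.mul_sum, ← cast_value, ← Finset.sum_div]
            simp only [mul_pow]
            rw [← Finset.mul_sum]
            have := mul_le_mul_of_nonneg_left (sum_sq_le hM x) (sq_nonneg θ)
            linarith
        _ ≤ _ := by
            rw [Real.exp_sum]
            exact Finset.prod_le_prod (fun _ _ => (Real.exp_pos _).le)
              fun j _ => exp_le_one_add (by positivity)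
    refine h1.trans (le_trans ?_ (mul_le_mul_of_nonneg_left h2 (Real.exp_pos _).le))
    rw [← Real.exp_add, Real.exp_le_exp]
    have e1 : θ * V = ε * M / 3 := by rw [hθ]; field_simp
    have e2 : θ ^ 2 / 2 * ((1 + V / M) * V) ≤ ε ^ 2 * M / 9 := by
      have : (1 + V / M) * V ≤ 2 * V ^ 2 / M := by
        have : 1 ≤ V / M := (one_le_div hMr).2 hVM
        calc _ ≤ (V / M + V / M) * V := by gcongr
          _ = _ := by ring
      calc _ ≤ θ ^ 2 / 2 * (2 * V ^ 2 / M) := by gcongr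
        _ = (θ * V) ^ 2 / M := by ring
        _ = _ := by rw [e1]; field_simp; norm_num
    have e3 : N * θ ≤ θ * V - 2 / 3 * ε * (θ * V) := by
      -- `(1 + ε) (1 - 2ε/3) ≥ 1` holds because `ε ≤ 1/2`.
      have : (N : ℝ) ≤ V - 2 / 3 * ε * V := by
        refine le_of_mul_le_mul_left (hxV.trans ?_) (show (0 : ℝ) < 1 + ε by linarith)
        have : 0 ≤ ε * (1 - 2 * ε) * V :=
          mul_nonneg (mul_nonneg hε.le (by linarith)) hVpos.le
        linarith
      nlinarith
    rw [e1] at e3 ⊢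
    have : 0 < ε ^ 2 * M := by positivity
    nlinarith

/-- The factors `1 - η * 2 ^ (j / M)` may become negative at high levels, so the product is replaced
by `0` above the last level `x` of value at most `(1 - ε) N`. -/
theorem lower_tail {M : ℕ} (hM : 0 < M) {ε : ℝ} (hε : 0 < ε) (hε' : ε < 1 / 2) (i : Fin k)
    (ops : List (Fin k)) (hN : M ≤ ops.count i) :
    (law M ops).toOuterMeasure {v | (value M (v i) : ℝ) ≤ (1 - ε) * (ops.count i : ℝ)} ≤
      ENNReal.ofReal (Real.exp (-(ε ^ 2 * M / 16))) := by
  set N := ops.count i with hNdef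
  have hMr : (0 : ℝ) < M := by exact_mod_cast hM
  have hNr : (M : ℝ) ≤ N := by exact_mod_cast hN
  classical
  set b := ⌊(1 - ε) * (N : ℝ)⌋₊ with hb
  have hb0 : 0 ≤ (1 - ε) * (N : ℝ) := by nlinarith
  -- Searching up to `b` loses nothing, since `y ≤ value M y`.
  set x := Nat.findGreatest (fun y => value M y ≤ b) b with hx
  have hxb : value M x ≤ b :=
    Nat.findGreatest_spec (P := fun y => value M y ≤ b) (Nat.zero_le b) (by simp [value])
  have hxV : (value M x : ℝ) ≤ (1 - ε) * N := (Nat.cast_le.2 hxb).trans (Nat.floor_le hb0)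
  set V : ℝ := (value M x : ℝ) with hV
  have hV0 : 0 ≤ V := Nat.cast_nonneg _
  have hVN : V ≤ N := by nlinarith
  have hNM : 1 ≤ (N : ℝ) / M := (one_le_div hMr).2 hNr
  have hVM : 1 + V / M ≤ 2 * N / M := by
    have : V / M ≤ N / M := by gcongr
    rw [mul_div_assoc]
    linarith
  -- The exponent gained is at least `ε t - 4 t² / M` with `t = η N`; this is largest at `t = ε M /
  -- 8`.
  set η : ℝ := ε * M / (8 * N) with hη
  have hNpos : (0 : ℝ) < N := by linarith
  have hη0 : 0 < η := by positivity
  have hη1 : ∀ j ≤ x, η * 2 ^ (j / M) ≤ 1 / 2 := fun j hj => by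
    have h1 : (2 : ℝ) ^ (j / M) ≤ 2 * N / M :=
      ((pow_le_pow_right₀ (by norm_num) (Nat.div_le_div_right hj)).trans
        (two_pow_div_le hM x)).trans hVM
    calc _ ≤ η * (2 * N / M) := by gcongr
      _ = ε / 4 := by rw [hη]; field_simp; norm_num
      _ ≤ _ := by linarith
  have hf0 : ∀ y, 0 ≤ η * (2 : ℝ) ^ (y / M) := fun y => by positivity
  have hηlt : η ≤ 1 / 2 := by
    have := hη1 0 (Nat.zero_le _)
    simpa using this
  refine law_tail_le M i
    (fun y => if y ≤ x then ∏ j ∈ Finset.range y, (1 - η * 2 ^ (j / M)) else 0) (1 - η)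
    (by linarith) ?_ ?_ ops _ (∏ j ∈ Finset.range x, (1 - η * 2 ^ (j / M))) _ ?_ ?_ ?_
  · intro y
    split_ifs with hy
    · exact Finset.prod_nonneg fun j hj => by
        linarith [hη1 j ((Finset.mem_range.1 hj).le.trans hy)]
    · exact le_rfl
  · intro y
    have hp : (2 : ℝ) ^ (y / M) ≠ 0 := by positivity
    rcases lt_trichotomy y x with hy | hy | hy
    · rw [if_pos (Nat.succ_le_of_lt hy), if_pos hy.le, Finset.prod_range_succ]
      refine le_of_eq ?_
      field_simp
      ring
    -- At the cutoff level only failure keeps a nonzero product, and `1 - 2 ^ -(x / M) ≤ 1 - η`.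
    · rw [if_neg (by omega), if_pos hy.le, mul_zero, zero_add]
      refine mul_le_mul_of_nonneg_right ?_ (Finset.prod_nonneg fun j hj => by
        linarith [hη1 j ((Finset.mem_range.1 hj).le.trans hy.le)])
      have h1 := hη1 y hy.le
      have : η ≤ ((2 : ℝ) ^ (y / M))⁻¹ := by
        rw [le_inv_comm₀ hη0 (by positivity), ← one_div, le_div_iff₀ hη0]
        linarith
      linarith
    · rw [if_neg (by omega), if_neg (by omega)]
      simp
  · exact Finset.prod_pos fun j hj => by linarith [hη1 j (Finset.mem_range.1 hj).le]
  · intro v hv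
    have hvb : value M (v i) ≤ b := Nat.le_floor hv
    have hvx : v i ≤ x :=
      Nat.le_findGreatest (((value_strictMono M).le_apply).trans hvb) hvb
    rw [if_pos hvx]
    exact Finset.prod_le_prod_of_subset_of_le_one (Finset.range_subset_range.2 hvx)
      (fun j hj => by linarith [hη1 j (Finset.mem_range.1 hj).le])
      (fun j _ _ => by linarith [hf0 j])
  · simp only [Nat.zero_le, if_true, Finset.range_zero, Finset.prod_empty, mul_one]
    have h1 : (1 - η) ^ N ≤ Real.exp (N * -η) := by
      rw [Real.exp_nat_mul]
      exact pow_le_pow_left₀ (by linarith) (by linarith [Real.add_one_le_exp (-η)]) _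
    have h2 : Real.exp (-(η * V) - 2 * η ^ 2 * ((1 + V / M) * V)) ≤
        ∏ j ∈ Finset.range x, (1 - η * 2 ^ (j / M)) := by
      calc _ ≤ Real.exp (∑ j ∈ Finset.range x,
            (-(η * 2 ^ (j / M)) - 2 * (η * 2 ^ (j / M)) ^ 2)) := by
            refine Real.exp_le_exp.2 ?_
            rw [Finset.sum_sub_distrib, Finset.sum_neg_distrib, ← Finset.mul_sum, ← cast_value,
              ← Finset.mul_sum]
            simp only [mul_pow]
            rw [← Finset.mul_sum]
            have := mul_le_mul_of_nonneg_left (sum_sq_le hM x) (sq_nonneg η)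
            linarith
        _ ≤ _ := by
            rw [Real.exp_sum]
            exact Finset.prod_le_prod (fun _ _ => (Real.exp_pos _).le)
              fun j hj => exp_le_one_sub (hη1 j (Finset.mem_range.1 hj).le)
    refine h1.trans (le_trans ?_ (mul_le_mul_of_nonneg_left h2 (Real.exp_pos _).le))
    rw [← Real.exp_add, Real.exp_le_exp]
    have e1 : η * N = ε * M / 8 := by rw [hη]; field_simp
    have e2 : 2 * η ^ 2 * ((1 + V / M) * V) ≤ ε ^ 2 * M / 16 := by
      calc _ ≤ 2 * η ^ 2 * (2 * N / M * N) := by gcongr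
        _ = 4 * (η * N) ^ 2 / M := by ring
        _ = _ := by rw [e1]; field_simp; norm_num
    have e3 : η * V ≤ (1 - ε) * (η * N) := by nlinarith
    rw [e1] at e3
    nlinarith

/-! ### Encoding counter states as bit strings. -/

/-- A self-delimiting binary code for `n`, followed by `r`. -/
def codeNat (n : ℕ) (r : List Bool) : List Bool :=
  if n = 0 then false :: r else true :: n.bodd :: codeNat n.div2 r
termination_by n
decreasing_by
  rw [Nat.div2_val]
  omega

theorem codeNat_inj (m : ℕ) : ∀ (n : ℕ) (r s : List Bool),
    codeNat m r = codeNat n s → m = n ∧ r = s := by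
  induction m using Nat.strong_induction_on with
  | _ m ih =>
    intro n r s h
    rw [codeNat.eq_def m, codeNat.eq_def n] at h
    by_cases hm : m = 0 <;> by_cases hn : n = 0
    · simp only [hm, hn, if_true, List.cons.injEq, true_and] at h ⊢
      exact h
    · simp [hm, hn] at h
    · simp [hm, hn] at h
    · simp only [hm, hn, if_false, List.cons.injEq, true_and] at h
      obtain ⟨h1, h2⟩ := ih m.div2 (by rw [Nat.div2_val]; omega) _ _ _ h.2
      refine ⟨?_, h2⟩
      rw [← Nat.bit_bodd_div2 m, ← Nat.bit_bodd_div2 n, h.1, h1]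

theorem length_codeNat (n : ℕ) (r : List Bool) :
    (codeNat n r).length = 2 * n.size + 1 + r.length := by
  induction n using Nat.strong_induction_on with
  | _ n ih =>
    rw [codeNat.eq_def]
    split_ifs with hn
    · simp [hn]
      omega
    · have h : n.size = n.div2.size + 1 := by
        conv_lhs => rw [← Nat.bit_bodd_div2 n]
        exact Nat.size_bit (by rwa [Nat.bit_bodd_div2])
      rw [List.length_cons, List.length_cons, ih n.div2 (by rw [Nat.div2_val]; omega), h]
      ring

theorem foldr_codeNat_inj : ∀ l m : List ℕ, l.length = m.length →
    l.foldr codeNat [] = m.foldr codeNat [] → l = m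
  | [], [], _, _ => rfl
  | a :: l, b :: m, hlen, h => by
    obtain ⟨h1, h2⟩ := codeNat_inj _ _ _ _ h
    rw [h1, foldr_codeNat_inj l m (by simpa using hlen) h2]

/-- The memory holding the vector `v` of counter states. -/
def code (v : Fin k → ℕ) : List Bool := (List.ofFn v).foldr codeNat []

theorem code_injective : Function.Injective (code (k := k)) := fun v w h =>
  List.ofFn_injective (foldr_codeNat_inj _ _ (by simp) h)

/-- The vector of counter states held in a memory. -/
noncomputable def decode (m : List Bool) : Fin k → ℕ := Function.invFun code m

theorem decode_code (v : Fin k → ℕ) : decode (code v) = v :=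
  Function.leftInverse_invFun code_injective v

theorem length_code (v : Fin k → ℕ) : (code v).length = ∑ i, (2 * (v i).size + 1) := by
  have h : ∀ l : List ℕ, (l.foldr codeNat []).length =
      (l.map fun n => 2 * n.size + 1).sum := fun l => by
    induction l with
    | nil => rfl
    | cons a l ih => rw [List.foldr_cons, length_codeNat, ih, List.map_cons, List.sum_cons]
  rw [code, h, List.map_ofFn, List.sum_ofFn]
  rfl

/-- Counter states never decrease, so the maximal memory length over a run is the final one. -/
theorem length_code_mono {v w : Fin k → ℕ} (h : v ≤ w) : (code v).length ≤ (code w).length := by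
  rw [length_code, length_code]
  refine Finset.sum_le_sum fun i _ => ?_
  have := Nat.size_le_size (h i)
  omega

/-! ### The algorithm and its correctness. -/

/-- The algorithm that keeps `k` independent dyadic counters. -/
noncomputable def alg (k M : ℕ) : CounterAlg k where
  init := PMF.pure (code (0 : Fin k → ℕ))
  increment i m := (vecStep M i (decode m)).map code
  query i m := PMF.pure (value M (decode m i))

theorem run_alg (M : ℕ) (ops : List (Fin k)) :
    (alg k M).run ops = (law M ops).map fun v => (code v, (code v).length) := by
  induction ops using List.reverseRecOn with
  | nil => simp [CounterAlg.run, alg, law_nil, PMF.pure_map]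
  | append_singleton ops i ih =>
    rw [law_concat, PMF.map_bind]
    have : (alg k M).run (ops ++ [i]) = ((alg k M).run ops).bind ((alg k M).step i) := by
      simp [CounterAlg.run]
    rw [this, ih, PMF.bind_map]
    congr 1
    funext v
    simp only [Function.comp, CounterAlg.step, alg, decode_code, vecStep, PMF.map_comp]
    congr 1
    funext b
    simp only [Function.comp, Prod.mk.injEq, true_and]
    refine max_eq_right (length_code_mono ?_)
    cases b with
    | true => exact le_update_iff.2 ⟨Nat.le_succ _, fun _ _ => le_rfl⟩
    | false => exact le_rfl

theorem answer_alg (M : ℕ) (ops : List (Fin k)) (i : Fin k) :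
    (alg k M).answer ops i = (law M ops).map fun v => (value M (v i) : ℝ) := by
  rw [CounterAlg.answer, run_alg, PMF.bind_map, ← PMF.bind_pure_comp]
  congr 1
  funext v
  simp [alg, decode_code]

theorem expectedSpace_alg (M : ℕ) (ops : List (Fin k)) :
    (alg k M).expectedSpace ops = (law M ops).expect fun v => ((code v).length : ℝ≥0∞) := by
  rw [CounterAlg.expectedSpace, run_alg]
  exact PMF.expect_map _ _ fun s : List Bool × ℕ => (s.2 : ℝ≥0∞)

theorem isApproxCounter_alg {M : ℕ} (hM : 0 < M) {ε δ : ℝ} (hε : 0 < ε) (hε' : ε < 1 / 2)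
    (hδ : 2 * Real.exp (-(ε ^ 2 * M / 16)) ≤ δ) : (alg k M).IsApproxCounter ε δ := by
  intro ops i
  rw [answer_alg, PMF.toOuterMeasure_map_apply]
  rcases le_total (ops.count i) M with h | h
  · refine le_of_eq_of_le ?_ zero_le
    rw [PMF.toOuterMeasure_apply_eq_zero_iff, Set.disjoint_left]
    intro v hv hS
    refine hS.1 ?_
    show (value M (v i) : ℝ) = _
    rw [eq_count_of_mem_support_law i ops h v hv, value_eq_self h]
  · refine le_trans (MeasureTheory.measure_mono (t :=
      {v : Fin k → ℕ | (1 + ε) * (ops.count i : ℝ) ≤ value M (v i)} ∪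
        {v | (value M (v i) : ℝ) ≤ (1 - ε) * (ops.count i : ℝ)}) ?_) ?_
    · rintro v ⟨-, hv⟩
      rcases le_abs.1 hv with hv | hv
      · left
        simp only [Set.mem_ofPred_eq]
        linarith
      · right
        simp only [Set.mem_ofPred_eq]
        linarith
    · refine (MeasureTheory.measure_union_le _ _).trans
        ((add_le_add (upper_tail hM hε hε' i ops h) (lower_tail hM hε hε' i ops h)).trans ?_)
      rw [← ENNReal.ofReal_add (Real.exp_pos _).le (Real.exp_pos _).le]
      exact ENNReal.ofReal_le_ofReal (by linarith)

/-! ### Expected space. -/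

theorem logb_two_one_add_le {t : ℝ} (ht : 0 ≤ t) : Real.logb 2 (1 + t) ≤ 2 * t := by
  have h1 : Real.log (1 + t) ≤ t := by
    linarith [Real.log_le_sub_one_of_pos (show 0 < 1 + t by linarith)]
  have h2 := Real.log_two_gt_d9
  rw [Real.logb, div_le_iff₀ (by linarith)]
  nlinarith

/-- The number of bits of a counter state, in terms of the value it represents. -/
theorem size_le_of_value {M : ℕ} (hM : 0 < M) {c : ℝ} (hc : 1 ≤ c) (x : ℕ) :
    (x.size : ℝ) ≤ Real.logb 2 M + 3 + Real.logb 2 (Real.logb 2 (2 * c)) + 8 / c * value M x := by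
  have hM1 : (1 : ℝ) ≤ M := by exact_mod_cast hM
  set V : ℝ := (value M x : ℝ) with hV
  have hV0 : 0 ≤ V := Nat.cast_nonneg _
  have hc0 : 0 < c := by linarith
  have hA : 1 ≤ Real.logb 2 (2 * c) := by
    rw [Real.le_logb_iff_rpow_le (by norm_num) (by linarith), Real.rpow_one]
    linarith
  have hVc : 0 ≤ V / c := by positivity
  -- Factoring out the reference value `c` leaves `log (1 + V / c)`, which is bounded linearly; the
  -- same device is applied to the outer logarithm below and replaces Jensen's inequality.
  have hlog1 : ((x / M : ℕ) : ℝ) ≤ Real.logb 2 (2 * c) + 2 * (V / c) := by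
    have h1 : (2 : ℝ) ^ (x / M) ≤ (2 * c) * (1 + V / c) := by
      refine (two_pow_div_le hM x).trans ?_
      have : V / M ≤ V := div_le_self hV0 hM1
      have : (2 * c) * (1 + V / c) = 2 * c + 2 * V := by field_simp
      linarith
    calc ((x / M : ℕ) : ℝ) = Real.logb 2 (2 ^ (x / M)) := by
          rw [Real.logb_pow, Real.logb_self_eq_one (by norm_num), mul_one]
      _ ≤ Real.logb 2 ((2 * c) * (1 + V / c)) :=
          Real.logb_le_logb_of_le (by norm_num) (by positivity) h1
      _ ≤ _ := by
          rw [Real.logb_mul (by positivity) (by positivity)]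
          linarith [logb_two_one_add_le hVc]
  have hx : (x : ℝ) ≤ M * (2 * Real.logb 2 (2 * c) * (1 + 2 * (V / c))) := by
    have h1 : (x : ℝ) ≤ M * ((x / M : ℕ) + 1) := by
      have h := (Nat.lt_div_mul_add (a := x) hM).le
      have h' : ((x : ℕ) : ℝ) ≤ ((x / M * M + M : ℕ) : ℝ) := Nat.cast_le.2 h
      push_cast at h' ⊢
      linarith
    refine h1.trans (mul_le_mul_of_nonneg_left ?_ (by linarith))
    nlinarith
  rcases Nat.eq_zero_or_pos x with h0 | h0
  · have : 0 ≤ Real.logb 2 M := Real.logb_nonneg (by norm_num) hM1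
    have : 0 ≤ Real.logb 2 (Real.logb 2 (2 * c)) := Real.logb_nonneg (by norm_num) hA
    have : 0 ≤ 8 / c * V := by positivity
    rw [h0, Nat.size_zero, Nat.cast_zero]
    linarith
  · have hsz : (x.size : ℝ) ≤ 1 + Real.logb 2 x := by
      have h1 : 2 ^ (x.size - 1) ≤ x :=
        Nat.lt_size.1 (Nat.sub_lt (Nat.size_pos.2 h0) one_pos)
      have h2 : (2 : ℝ) ^ (x.size - 1) ≤ x := by exact_mod_cast h1
      have h3 := Real.logb_le_logb_of_le (b := 2) (by norm_num) (by positivity) h2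
      rw [Real.logb_pow, Real.logb_self_eq_one (by norm_num), mul_one,
        Nat.cast_sub (Nat.size_pos.2 h0), Nat.cast_one] at h3
      linarith
    have h4 := Real.logb_le_logb_of_le (b := 2) (by norm_num) (by exact_mod_cast h0) hx
    rw [Real.logb_mul (by positivity) (by positivity),
      Real.logb_mul (by positivity) (by positivity),
      Real.logb_mul (by norm_num) (by positivity), Real.logb_self_eq_one (by norm_num)] at h4
    have h5 := logb_two_one_add_le (show 0 ≤ 2 * (V / c) by positivity)
    have h6 : 8 / c * V = 8 * (V / c) := by ring
    rw [h6]
    linarith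

/-- With `c = N / k`, the linear terms have total mean `(16 / c) N = 16 k`; with the `7` per counter
from code lengths this gives `23`. -/
theorem expectedSpace_alg_le {M : ℕ} (hM : 0 < M) (hk : 1 ≤ k) (ops : List (Fin k))
    (hops : k ≤ ops.length) :
    (alg k M).expectedSpace ops ≤ ENNReal.ofReal
      (k * (2 * Real.logb 2 M + 23 +
        2 * Real.logb 2 (Real.logb 2 (2 * (ops.length : ℝ) / k)))) := by
  have hk0 : (0 : ℝ) < k := by exact_mod_cast hk
  set c : ℝ := (ops.length : ℝ) / k with hcdef
  have hc : 1 ≤ c := (one_le_div hk0).2 (by exact_mod_cast hops)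
  have hM1 : (1 : ℝ) ≤ M := by exact_mod_cast hM
  have hA : 1 ≤ Real.logb 2 (2 * c) := by
    rw [Real.le_logb_iff_rpow_le (by norm_num) (by linarith), Real.rpow_one]
    linarith
  have hL : 0 ≤ Real.logb 2 (Real.logb 2 (2 * c)) := Real.logb_nonneg (by norm_num) hA
  have hLM : 0 ≤ Real.logb 2 M := Real.logb_nonneg (by norm_num) hM1
  rw [mul_div_assoc, ← hcdef, expectedSpace_alg]
  set B : ℝ := 2 * Real.logb 2 M + 7 + 2 * Real.logb 2 (Real.logb 2 (2 * c)) with hB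
  have hB0 : 0 ≤ B := by linarith
  have hc0 : 0 ≤ 16 / c := by positivity
  calc ((law M ops).expect fun v => ((code v).length : ℝ≥0∞))
      ≤ (law M ops).expect fun v => ENNReal.ofReal (k * B) +
          ENNReal.ofReal (16 / c) * ∑ i, (value M (v i) : ℝ≥0∞) := by
        refine PMF.expect_mono _ fun v => ?_
        have hS : (∑ i, (value M (v i) : ℝ≥0∞)) =
            ENNReal.ofReal (∑ i, (value M (v i) : ℝ)) := by
          rw [ENNReal.ofReal_sum_of_nonneg fun i _ => Nat.cast_nonneg _]
          simp
        rw [hS, ← ENNReal.ofReal_mul hc0, ← ENNReal.ofReal_add (by positivity)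
          (mul_nonneg hc0 (Finset.sum_nonneg fun _ _ => Nat.cast_nonneg _)),
          ← ENNReal.ofReal_natCast]
        refine ENNReal.ofReal_le_ofReal ?_
        rw [length_code, Finset.mul_sum]
        push_cast
        calc ∑ i, (2 * ((v i).size : ℝ) + 1)
            ≤ ∑ i, (B + 16 / c * (value M (v i) : ℝ)) := by
              refine Finset.sum_le_sum fun i _ => ?_
              have h1 := size_le_of_value hM hc (v i)
              have h2 : 16 / c * (value M (v i) : ℝ) = 2 * (8 / c * (value M (v i) : ℝ)) := by ring
              rw [h2]
              linarith
          _ = _ := by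
              rw [Finset.sum_add_distrib]
              simp
    _ = ENNReal.ofReal (k * B) + ENNReal.ofReal (16 / c) * ops.length := by
        rw [PMF.expect_add, PMF.expect_const, PMF.expect_const_mul, expect_sum_value]
    _ = ENNReal.ofReal (k * B + 16 * k) := by
        rw [← ENNReal.ofReal_natCast, ← ENNReal.ofReal_mul hc0,
          ← ENNReal.ofReal_add (by positivity) (by positivity)]
        congr 2
        have : (ops.length : ℝ) = c * k := by rw [hcdef]; field_simp
        rw [this]
        field_simp
    _ ≤ _ := ENNReal.ofReal_le_ofReal (by rw [hB]; linarith)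

end DyadicCounter

/-! ### Choice of parameters. -/

theorem mainTheorem5 :
    ∃ C : ℝ, 0 < C ∧
      ∀ ε δ : ℝ, 0 < ε → ε < 1 / 2 → 0 < δ → δ < 1 / 2 →
      ∀ k : ℕ, 1 ≤ k →
        ∃ A : CounterAlg k,
          A.IsApproxCounter ε δ ∧
          ∀ (N : ℕ) (ops : List (Fin k)), ops.length = N → k ≤ N →
            A.expectedSpace ops ≤ ENNReal.ofReal
              (C * ((k : ℝ) *
                (Real.logb 2 (Real.logb 2 (2 * (N : ℝ) / (k : ℝ)))
                  + Real.logb 2 (Real.logb 2 (1 / δ))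
                  + Real.logb 2 (1 / ε)))) := by
  -- `2 log M + 23` contributes the constant `12 + 23 = 35`, absorbed by `log (1/ε) ≥ 1`, and a
  -- further `4 log (1/ε)`.
  refine ⟨39, by norm_num, fun ε δ hε hε' hδ hδ' k hk => ?_⟩
  set D := Real.logb 2 (1 / δ) with hD
  have hD1 : 1 ≤ D := by
    rw [hD, Real.le_logb_iff_rpow_le (by norm_num) (by positivity), Real.rpow_one,
      le_div_iff₀ hδ]
    linarith
  have hE1 : 1 ≤ Real.logb 2 (1 / ε) := by
    rw [Real.le_logb_iff_rpow_le (by norm_num) (by positivity), Real.rpow_one, le_div_iff₀ hε]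
    linarith
  -- The factor `32` makes `ε² M / 16 ≥ 2 D ≥ ln (2/δ)`, so each tail has probability at most `δ /
  -- 2`.
  set M := ⌈32 * D / ε ^ 2⌉₊ with hMdef
  have hq : 1 ≤ D / ε ^ 2 := by
    rw [one_le_div (by positivity)]
    nlinarith
  have hMge : 32 * D / ε ^ 2 ≤ M := Nat.le_ceil _
  have hM : 0 < M := Nat.ceil_pos.2 (by positivity)
  have hMle : (M : ℝ) ≤ 2 ^ 6 * (D * (1 / ε) ^ 2) := by
    have h1 : (M : ℝ) < 32 * D / ε ^ 2 + 1 := Nat.ceil_lt_add_one (by positivity)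
    have h2 : 32 * D / ε ^ 2 = 32 * (D / ε ^ 2) := by ring
    have h3 : (2 : ℝ) ^ 6 * (D * (1 / ε) ^ 2) = 64 * (D / ε ^ 2) := by ring
    linarith
  have hlogM : Real.logb 2 M ≤ 6 + Real.logb 2 D + 2 * Real.logb 2 (1 / ε) := by
    have h := Real.logb_le_logb_of_le (b := 2) (by norm_num) (by exact_mod_cast hM) hMle
    rw [Real.logb_mul (by positivity) (by positivity),
      Real.logb_mul (by positivity) (by positivity), Real.logb_pow, Real.logb_pow,
      Real.logb_self_eq_one (by norm_num)] at h
    push_cast at h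
    linarith
  refine ⟨DyadicCounter.alg k M, DyadicCounter.isApproxCounter_alg hM hε hε' ?_, ?_⟩
  · have h1 : 2 * D ≤ ε ^ 2 * M / 16 := by
      rw [div_le_iff₀ (by positivity)] at hMge
      linarith
    have h2 : Real.log (2 / δ) ≤ 2 * D := by
      have h3 : Real.log (1 / δ) ≤ D := by
        rw [hD, Real.logb]
        exact le_div_self (Real.log_nonneg (by rw [one_le_div hδ]; linarith))
          (Real.log_pos (by norm_num)) (by linarith [Real.log_two_lt_d9])
      rw [show 2 / δ = 2 * (1 / δ) by ring, Real.log_mul (by norm_num) (by positivity)]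
      linarith [Real.log_two_lt_d9]
    have h3 : Real.exp (-(ε ^ 2 * M / 16)) ≤ δ / 2 := by
      rw [← Real.le_log_iff_exp_le (by positivity), ← inv_div 2 δ, Real.log_inv]
      linarith
    linarith
  · rintro N ops rfl hN
    refine (DyadicCounter.expectedSpace_alg_le hM hk ops hN).trans
      (ENNReal.ofReal_le_ofReal ?_)
    have hk0 : (0 : ℝ) < k := by exact_mod_cast hk
    have hA : 1 ≤ Real.logb 2 (2 * (ops.length : ℝ) / k) := by
      have : (k : ℝ) ≤ ops.length := by exact_mod_cast hN
      have : 2 ≤ 2 * (ops.length : ℝ) / k := by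
        rw [le_div_iff₀ hk0]
        linarith
      rwa [Real.le_logb_iff_rpow_le (by norm_num) (by linarith), Real.rpow_one]
    have hL := Real.logb_nonneg (b := 2) (by norm_num) hA
    have hLD : 0 ≤ Real.logb 2 D := Real.logb_nonneg (by norm_num) hD1
    rw [mul_left_comm]
    exact mul_le_mul_of_nonneg_left (by linarith) hk0.le
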